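/- **Setting.** A finite set of jobs has to be scheduled preemptively on a single machine. Job $j$ has a release date $r_j$, a processing time $p_j\ge 0$ and a deadline $d_j$. Let $0<\varepsilon\le 1$, and assume that every job satisfies $d_j-r_j\ge(1+\varepsilon)p_j$. **The region algorithm** with parameters $\alpha\ge 1$, $0<\beta<1$ and $\delta>0$ works as follows. It keeps for each admitted job $j$ a region $R(j)$, which is a union of time intervals. At time $t$ a job is *available* if $r_j\le t$, it is not yet admitted, and $d_j-t\ge(1+\delta)p_j$. Whenever a job is released or a region ends, say at time $t$, let $i$ be a shortest available job (ties broken arbitrarily), and let $k$ be the job whose region contains $t$. If $p_i<\beta p_k$, or if no region contains $t$, then $i$ is admitted at time $t$: it receives the region $R(i)=[t,t+\alpha p_i)$, and the part in $[t,\infty)$ of every other region is delayed by $\alpha p_i$. Independently of the regions, the machine at any time runs an admitted and not yet completed job with shortest processing time, and it idles only if there is no such job. A job is *completed before its deadline* if it receives $p_j$ units of processing within $[r_j,d_j]$. **Theorem.** Let $\alpha=1$, $\beta=\frac{\varepsilon}{4}$ and $\delta=\frac{\varepsilon}{2}$. Then the region algorithm has an execution on the instance, and every execution completes at least half of all the jobs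 that it admits before their deadlines. -/

import Mathlib

namespace RegionScheduling

open Set MeasureTheory

/-- A single-machine instance: every job has a release date, a processing time and a deadline. -/
structure JobInstance (J : Type*) where
  release : J → ℝ
  proc : J → ℝ
  deadline : J → ℝ
  proc_nonneg : ∀ j, 0 ≤ proc j

/-- What the algorithm remembers: the admission date of every admitted job (`none` for a job that
has not been admitted), and the current region of every job (empty for a job that has not been
admitted). -/
structure State (J : Type*) where
  admission : J → Option ℝ
  region : J → Set ℝ

/-- Nothing is admitted. -/
def State.initial (J : Type*) : State J where
  admission := fun _ => none
  region := fun _ => ∅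

/-- The jobs that have been admitted. -/
def State.admitted {J : Type*} (s : State J) : Set J := {j | s.admission j ≠ none}

namespace JobInstance

variable {J : Type*} (I : JobInstance J)

/-- Every job has slack at least an `ε`-fraction of its processing time. -/
def HasSlack (ε : ℝ) : Prop :=
  ∀ j, (1 + ε) * I.proc j ≤ I.deadline j - I.release j

/-- Job `j` is available at time `t`: released, not yet admitted, not too close to its deadline. -/
def Available (δ : ℝ) (s : State J) (t : ℝ) (j : J) : Prop :=
  I.release j ≤ t ∧ s.admission j = none ∧ (1 + δ) * I.proc j ≤ I.deadline j - t

/-- The region preemption routine, called at time `t`, admits job `i`: it is a shortest available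
job (ties are broken arbitrarily), and it is shorter than `β` times the job whose region
contains `t`. The second condition is void if no region contains `t`. -/
def Admits (β δ : ℝ) (s : State J) (t : ℝ) (i : J) : Prop :=
  I.Available δ s t i ∧ (∀ j, I.Available δ s t j → I.proc i ≤ I.proc j) ∧
    ∀ k, t ∈ s.region k → I.proc i < β * I.proc k

open Classical in
/-- Admission of job `i` at time `t`: the interval `[t, t + α pᵢ)` is reserved for `i`, and the
part in `[t, ∞)` of every other region is delayed by `α pᵢ` (so an interval `[a, b)` that contains
`t` becomes `[a, t) ∪ [t + α pᵢ, b + α pᵢ)`). -/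
noncomputable def reserve (α : ℝ) (s : State J) (t : ℝ) (i : J) : State J where
  admission := fun j => if j = i then some t else s.admission j
  region := fun j =>
    if j = i then Ico t (t + α * I.proc i)
    else (s.region j ∩ Iio t) ∪ (fun x => x + α * I.proc i) '' (s.region j ∩ Ici t)

/-- The events that trigger a call of the routine: a job is released, or a region ends. -/
def IsEvent (s : State J) (t : ℝ) : Prop :=
  (∃ j, I.release j = t) ∨ ∃ j, IsLUB (s.region j) t

/-- `I.Reaches α β δ t s`: some run of the region algorithm is in state `s` at time `t`.
The run starts before or at the first release. At an event the routine is called until it admits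
no job, then the algorithm waits for the next event. After the admission of a job of positive
length a further call at the same time admits nothing (for `α > 0` and `β ≤ 1`), because all
available jobs are at least as long as the job whose region now contains `t`. The region of a job
of length zero ends at the time at which it starts, and triggers another call. -/
inductive Reaches (α β δ : ℝ) : ℝ → State J → Prop
  | start (t : ℝ) (h : ∀ j, t ≤ I.release j) : Reaches α β δ t (State.initial J)
  | admission (t : ℝ) (s : State J) (i : J) (h : Reaches α β δ t s) (hi : I.Admits β δ s t i) :
      Reaches α β δ t (I.reserve α s t i)
  | wait (t t' : ℝ) (s : State J) (h : Reaches α β δ t s) (hn : ∀ i, ¬ I.Admits β δ s t i)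
      (ht : IsLeast {u | t < u ∧ I.IsEvent s u} t') : Reaches α β δ t' s

/-- `s` is the state at the end of a run: nothing is admitted and no event is left. -/
def IsOutcome (α β δ : ℝ) (s : State J) : Prop :=
  ∃ t, I.Reaches α β δ t s ∧ (∀ i, ¬ I.Admits β δ s t i) ∧ ∀ u, t < u → ¬ I.IsEvent s u

/-- For admission dates `a` and a schedule `σ` (`σ t` is the job that is run at time `t`, `none`
if the machine is idle): job `j` is admitted before or at time `t`, and has received less than
`pⱼ` units of processing before time `t`. -/
def Pending (a : J → Option ℝ) (σ : ℝ → Option J) (t : ℝ) (j : J) : Prop :=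
  (∃ τ, a j = some τ ∧ τ ≤ t) ∧
    volume {x | x < t ∧ σ x = some j} < ENNReal.ofReal (I.proc j)

/-- The scheduling routine: at any time run an admitted and not yet completed job with shortest
processing time. -/
structure IsSPTSchedule (a : J → Option ℝ) (σ : ℝ → Option J) : Prop where
  measurable : ∀ j, MeasurableSet {t | σ t = some j}
  run : ∀ t j, σ t = some j → I.Pending a σ t j ∧ ∀ k, I.Pending a σ t k → I.proc j ≤ I.proc k
  idle : ∀ t, σ t = none → ∀ k, ¬ I.Pending a σ t k

/-- A complete execution of the region algorithm, with parameters `α`, `β`, `δ`: the final state,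
and the schedule that the scheduling routine makes of the admitted jobs. -/
def IsExecution (α β δ : ℝ) (s : State J) (σ : ℝ → Option J) : Prop :=
  I.IsOutcome α β δ s ∧ I.IsSPTSchedule s.admission σ

/-- The schedule completes job `j` before its deadline: `j` receives at least `pⱼ` units of
processing in `[rⱼ, dⱼ]`. -/
def CompletesOnTime (σ : ℝ → Option J) (j : J) : Prop :=
  ENNReal.ofReal (I.proc j) ≤
    volume {x | x ∈ Icc (I.release j) (I.deadline j) ∧ σ x = some j}

end JobInstance

end RegionScheduling

/-! With `α = 1` a region has exactly the length of its job, and an admission inserts an interval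
into the time line. Hence the spans (from admission to end of region) are disjoint or nested, and an
inner job is shorter than `β` times any job around it (`Laminar.reserve`). The region containing a
time belongs to the shortest job whose span contains it, so shortest-processing-time scheduling runs
each job exactly in its region (`Laminar.eq_some_iff`), and a job is on time once its span ends by
its deadline.

The rest is counting (`sum_sign_nonneg`). In the forest of spans, let `D j` be the number of jobs on
time minus the number of late ones in the subtree of `j`. By induction from the leaves, `D j ≥ 1`
and the span of `j` has length at most `D j` times `p j`: a late job admitted with slack `2β` has
inner spans of total length above `2β p j`, while these are at most `β p j` times the sum of the
children's `D`, so that integer sum is at least 3. Summing over the roots gives the claim. -/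

namespace RegionScheduling

open Set MeasureTheory

/-! ### Counting in weighted forests -/

section Forest

variable {T : Type*} [Fintype T]

/-- A node weight on a finite forest can be summed over subtrees. -/
lemma exists_subtree_sum [DecidableEq T] (p : T → ℝ) (parent : T → Option T)
    (hpar : ∀ c j, parent c = some j → p c < p j) (f : T → ℤ) :
    ∃ D : T → ℤ, ∀ j, D j = f j + ∑ c, if parent c = some j then D c else 0 := by
  classical
  have wf : WellFounded (fun c j : T => p c < p j) :=
    @Finite.wellFounded_of_trans_of_irrefl T _ _ ⟨fun _ _ _ => lt_trans⟩ ⟨fun _ => lt_irrefl _⟩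
  refine ⟨wf.fix fun j D => f j + ∑ c, if h : parent c = some j then D c (hpar c j h) else 0, ?_⟩
  intro j
  rw [WellFounded.fix_eq]
  rfl

/-- The sum of all node weights is the sum of the subtree sums of the roots. -/
lemma sum_eq_sum_roots [DecidableEq T] (parent : T → Option T) (f D : T → ℤ)
    (hD : ∀ j, D j = f j + ∑ c, if parent c = some j then D c else 0) :
    ∑ j, f j = ∑ j, if parent j = none then D j else 0 := by
  have h1 : ∑ j, D j = ∑ j, f j + ∑ j, ∑ c, if parent c = some j then D c else 0 := by
    rw [← Finset.sum_add_distrib]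
    exact Finset.sum_congr rfl fun j _ => hD j
  -- Each node is a root or a child of exactly one node, so the child terms cancel in the double
  -- sum.
  have h2 : ∀ c, D c = (if parent c = none then D c else 0)
      + ∑ j, if parent c = some j then D c else 0 := by
    intro c
    cases h : parent c <;> simp
  have h3 : ∑ j, D j = ∑ j, (if parent j = none then D j else 0)
      + ∑ c, ∑ j, if parent c = some j then D c else 0 := by
    rw [← Finset.sum_add_distrib]
    exact Finset.sum_congr rfl fun j _ => h2 j
  rw [Finset.sum_comm] at h3
  linarith

/-- In a forest in which every node is shorter than `β ≤ 1/4` times its parent and the span `w` of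
a node is covered by the node itself and the spans of its children, the nodes whose span exceeds
`1 + 2 β` times their length are at most as many as the other ones. -/
lemma sum_sign_nonneg [DecidableEq T] (p w : T → ℝ) (parent : T → Option T) (late : T → Prop)
    [DecidablePred late] {β : ℝ} (hβ0 : 0 < β) (hβ1 : β ≤ 1 / 4) (hp : ∀ j, 0 ≤ p j)
    (hpar : ∀ c j, parent c = some j → p c < β * p j)
    (hw : ∀ j, w j ≤ p j + ∑ c, if parent c = some j then w c else 0)
    (hlate : ∀ j, late j → (1 + 2 * β) * p j < w j) :
    0 ≤ ∑ j, if late j then (-1 : ℤ) else 1 := by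
  have hlt : ∀ c j, parent c = some j → p c < p j := fun c j h => by
    nlinarith [hpar c j h, hp j]
  obtain ⟨D, hD⟩ := exists_subtree_sum p parent hlt (fun j => if late j then (-1 : ℤ) else 1)
  -- The bound on `w` is what makes the induction work: it turns a long span into a surplus of nodes
  -- that are not late.
  have key : ∀ j, 1 ≤ D j ∧ w j ≤ p j * D j := by
    have wf : WellFounded (fun c j : T => p c < p j) :=
      @Finite.wellFounded_of_trans_of_irrefl T _ _ ⟨fun _ _ _ => lt_trans⟩ ⟨fun _ => lt_irrefl _⟩
    intro j
    induction j using wf.induction with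
    | _ j ih =>
    set S : ℤ := ∑ c, if parent c = some j then D c else 0 with hS
    have hS0 : 0 ≤ S := Finset.sum_nonneg fun c _ => by
      split_ifs with h
      · linarith [(ih c (hlt c j h)).1]
      · exact le_rfl
    have hwS : w j ≤ p j + β * p j * S := by
      refine (hw j).trans (add_le_add le_rfl ?_)
      rw [hS, Int.cast_sum, Finset.mul_sum]
      refine Finset.sum_le_sum fun c _ => ?_
      split_ifs with h
      · have h1 := ih c (hlt c j h)
        have h2 : (0 : ℝ) ≤ D c := by exact_mod_cast (by linarith [h1.1] : (0 : ℤ) ≤ D c)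
        exact h1.2.trans (mul_le_mul_of_nonneg_right (hpar c j h).le h2)
      · simp
    have hS0' : (0 : ℝ) ≤ S := by exact_mod_cast hS0
    have hβS : β * S ≤ 1 / 4 * S := mul_le_mul_of_nonneg_right hβ1 hS0'
    have hDj := hD j
    rw [← hS] at hDj
    by_cases hl : late j
    · rw [if_pos hl] at hDj
      have h1 := hlate j hl
      have hpos : 0 < β * p j := by
        rcases (hp j).eq_or_lt with h0 | h0
        · rw [← h0] at h1 hwS
          simp at h1 hwS
          linarith
        · positivity
      -- `(1 + 2β) p < w ≤ p + β p S` forces `S > 2`; integrality then improves this to `S ≥ 3`.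
      have h2 : (2 : ℝ) < S := by
        by_contra hcon
        nlinarith
      have h3 : (3 : ℤ) ≤ S := by
        have : (2 : ℤ) < S := by exact_mod_cast h2
        omega
      have h3' : (3 : ℝ) ≤ S := by exact_mod_cast h3
      refine ⟨by omega, hwS.trans ?_⟩
      -- Here `D = S - 1`, and `1 + β S ≤ 1 + S / 4 ≤ S - 1` as soon as `S ≥ 8/3`.
      rw [hDj]
      push_cast
      nlinarith [hp j]
    · rw [if_neg hl] at hDj
      refine ⟨by omega, hwS.trans ?_⟩
      rw [hDj]
      push_cast
      nlinarith [hp j]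
  rw [sum_eq_sum_roots parent _ D hD]
  refine Finset.sum_nonneg fun j _ => ?_
  split_ifs
  · linarith [(key j).1]
  · exact le_rfl

end Forest

namespace JobInstance

variable {J : Type*} (I : JobInstance J)

/-! ### Nested spans as an invariant of the algorithm -/

/-- The regions of a state are laid out in nested spans: the span of an admitted job `j` is
`[a j, e j)`, from its admission to the end of its region. -/
structure Laminar (β δ : ℝ) (s : State J) (a e : J → ℝ) : Prop where
  admission_eq : ∀ j τ, s.admission j = some τ → τ = a j
  region_empty : ∀ j, s.admission j = none → s.region j = ∅
  release_le : ∀ j ∈ s.admitted, I.release j ≤ a j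
  slack : ∀ j ∈ s.admitted, (1 + δ) * I.proc j ≤ I.deadline j - a j
  start_le_end : ∀ j ∈ s.admitted, a j ≤ e j
  region_subset : ∀ j, s.region j ⊆ Ico (a j) (e j)
  measurable : ∀ j, MeasurableSet (s.region j)
  volume_region : ∀ j ∈ s.admitted, volume (s.region j) = ENNReal.ofReal (I.proc j)
  right_open : ∀ j, ∀ x ∈ s.region j, ∃ y, x < y ∧ Ico x y ⊆ s.region j
  disjoint : ∀ i j x, x ∈ s.region i → x ∈ s.region j → i = j
  cover : ∀ j ∈ s.admitted, ∀ x ∈ Ico (a j) (e j), ∃ k, x ∈ s.region k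
  top : ∀ k x, x ∈ s.region k → ∀ j ∈ s.admitted, j ≠ k → x ∈ Ico (a j) (e j) →
    I.proc k < β * I.proc j
  nested : ∀ i ∈ s.admitted, ∀ j ∈ s.admitted, i ≠ j →
    e i ≤ a j ∨ e j ≤ a i ∨ (a j ≤ a i ∧ e i ≤ e j ∧ I.proc i < β * I.proc j) ∨
      (a i ≤ a j ∧ e j ≤ e i ∧ I.proc j < β * I.proc i)

variable {I}

lemma mem_region_reserve_self {s : State J} {t x : ℝ} {i : J} :
    x ∈ (I.reserve 1 s t i).region i ↔ t ≤ x ∧ x < t + I.proc i := by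
  simp [reserve]

lemma mem_region_reserve {s : State J} {t x : ℝ} {i j : J} (h : j ≠ i) :
    x ∈ (I.reserve 1 s t i).region j ↔
      (x < t ∧ x ∈ s.region j) ∨ (t + I.proc i ≤ x ∧ x - I.proc i ∈ s.region j) := by
  simp only [reserve, if_neg h, one_mul, mem_union, mem_inter_iff, mem_Iio, mem_image, mem_Ici]
  constructor
  · rintro (h | ⟨y, h, rfl⟩)
    · exact .inl ⟨h.2, h.1⟩
    · exact .inr ⟨by linarith [h.2], by simpa using h.1⟩
  · rintro (h | h)
    · exact .inl ⟨h.2, h.1⟩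
    · exact .inr ⟨x - I.proc i, ⟨h.2, by linarith [h.1]⟩, by ring⟩

lemma mem_admitted_reserve {s : State J} {t : ℝ} {i j : J} :
    j ∈ (I.reserve 1 s t i).admitted ↔ j = i ∨ j ∈ s.admitted := by
  by_cases h : j = i <;> simp [State.admitted, reserve, h]

lemma volume_region_reserve {s : State J} {t : ℝ} {i j : J} (h : j ≠ i)
    (hm : MeasurableSet (s.region j)) :
    MeasurableSet ((I.reserve 1 s t i).region j) ∧
      volume ((I.reserve 1 s t i).region j) = volume (s.region j) := by
  have him : (fun x => x + 1 * I.proc i) '' (s.region j ∩ Ici t)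
      = (fun x => x - I.proc i) ⁻¹' (s.region j ∩ Ici t) := by
    ext x
    simp only [one_mul, mem_image, mem_preimage]
    exact ⟨by rintro ⟨y, hy, rfl⟩; simpa using hy, fun hx => ⟨_, hx, by ring⟩⟩
  have hmi : MeasurableSet (s.region j ∩ Ici t) := hm.inter measurableSet_Ici
  have hmp : MeasurableSet ((fun x => x - I.proc i) ⁻¹' (s.region j ∩ Ici t)) :=
    (measurable_id.sub_const _) hmi
  have hr : (I.reserve 1 s t i).region j
      = (s.region j ∩ Iio t) ∪ (fun x => x - I.proc i) ⁻¹' (s.region j ∩ Ici t) := by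
    simp only [reserve, if_neg h, him]
  have hv : volume ((fun x => x - I.proc i) ⁻¹' (s.region j ∩ Ici t))
      = volume (s.region j ∩ Ici t) :=
    (measurePreserving_sub_right volume (I.proc i)).measure_preimage hmi.nullMeasurableSet
  have hp := I.proc_nonneg i
  rw [hr]
  refine ⟨(hm.inter measurableSet_Iio).union hmp, ?_⟩
  rw [measure_union _ hmp, hv, ← measure_inter_add_sdiff (s.region j) measurableSet_Iio (t := Iio t)]
  · congr 2
    ext x
    simp
  · refine Set.disjoint_left.2 fun x hx hx' => ?_
    have h1 : x < t := hx.2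
    have h2 : t ≤ x - I.proc i := hx'.2
    linarith

/-- The time line is cut at `t` and an interval of length `p i` is inserted. All earlier admissions
are at or before `t`, so a span either is over by `t` and stays, or contains `t` and grows around
the new one. Points outside the new interval inherit their properties from the old time line. -/
lemma Laminar.reserve {β δ : ℝ} (hβ0 : 0 ≤ β) (hβ1 : β ≤ 1) {s : State J} {a e : J → ℝ}
    (h : I.Laminar β δ s a e) {t : ℝ} (ht : ∀ j ∈ s.admitted, a j ≤ t) {i : J}
    (hi : I.Admits β δ s t i) :
    ∃ a' e', I.Laminar β δ (I.reserve 1 s t i) a' e' ∧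
      ∀ j ∈ (I.reserve 1 s t i).admitted, a' j ≤ t := by
  classical
  obtain ⟨⟨hrel, hnone, hsl⟩, -, hshort⟩ := hi
  have hp := I.proc_nonneg i
  have hiR : ∀ x, x ∉ s.region i := fun x => by simp [h.region_empty i hnone]
  have hadm : ∀ j, j ≠ i → j ∈ (I.reserve 1 s t i).admitted → j ∈ s.admitted := fun j hj hj' =>
    (mem_admitted_reserve.1 hj').resolve_left hj
  have hne : ∀ j x, x ∈ s.region j → j ≠ i := fun j x hx hji => hiR x (hji ▸ hx)
  have hmemadm : ∀ j x, x ∈ s.region j → j ∈ s.admitted := fun j x hx hj => by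
    simp [h.region_empty j hj] at hx
  -- Every job whose span contains `t` is at least as long as the job `k` whose region contains `t`,
  -- so the admission test against `k` alone suffices.
  have hstack : ∀ j ∈ s.admitted, t < e j → I.proc i < β * I.proc j := by
    intro j hj hte
    obtain ⟨k, hk⟩ := h.cover j hj t ⟨ht j hj, hte⟩
    have h1 := hshort k hk
    by_cases hjk : j = k
    · rwa [hjk]
    · have h2 := h.top k t hk j hj hjk ⟨ht j hj, hte⟩
      have h3 := I.proc_nonneg k
      nlinarith
  set a' : J → ℝ := fun j => if j = i then t else a j with ha'
  set e' : J → ℝ := fun j => if j = i then t + I.proc i else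
    if t < e j then e j + I.proc i else e j with he'
  have hai : a' i = t := by simp [ha']
  have hei : e' i = t + I.proc i := by simp [he']
  have haj : ∀ j, j ≠ i → a' j = a j := fun j hj => by simp [ha', hj]
  have hel : ∀ j, j ≠ i → t < e j → e' j = e j + I.proc i := fun j hj hj' => by simp [he', hj, hj']
  have her : ∀ j, j ≠ i → e j ≤ t → e' j = e j := fun j hj hj' => by
    simp [he', hj, not_lt.2 hj']
  have hle : ∀ j, j ≠ i → e j ≤ e' j := fun j hj => by
    rcases lt_or_ge t (e j) with h1 | h1
    · rw [hel j hj h1]; linarith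
    · rw [her j hj h1]
  -- pulling a time outside the new region back to the old time line
  have hback1 : ∀ j, j ≠ i → ∀ x, x < t → x ∈ Ico (a' j) (e' j) → x ∈ Ico (a j) (e j) := by
    intro j hj x hxt hx
    rw [haj j hj] at hx
    refine ⟨hx.1, ?_⟩
    rcases lt_or_ge t (e j) with h1 | h1
    · linarith
    · rw [her j hj h1] at hx; exact hx.2
  have hback2 : ∀ j ∈ s.admitted, j ≠ i → ∀ x, t + I.proc i ≤ x → x ∈ Ico (a' j) (e' j) →
      x - I.proc i ∈ Ico (a j) (e j) := by
    intro j hjs hj x hxt hx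
    rw [haj j hj] at hx
    refine ⟨by linarith [ht j hjs], ?_⟩
    rcases lt_or_ge t (e j) with h1 | h1
    · rw [hel j hj h1] at hx; linarith [hx.2]
    · rw [her j hj h1] at hx; linarith [hx.2]
  have hmid : ∀ j, j ≠ i → ∀ x, t ≤ x → x < e' j → t < e j := by
    intro j hj x hx hxe
    by_contra h1
    rw [her j hj (not_lt.1 h1)] at hxe
    linarith
  refine ⟨a', e', ⟨?_, ?_, ?_, ?_, ?_, ?_, ?_, ?_, ?_, ?_, ?_, ?_, ?_⟩, ?_⟩
  · intro j τ hj
    by_cases hji : j = i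
    · subst hji; simpa [JobInstance.reserve, ha', eq_comm] using hj
    · rw [haj j hji]; exact h.admission_eq j τ (by simpa [JobInstance.reserve, hji] using hj)
  · intro j hj
    by_cases hji : j = i
    · subst hji; simp [JobInstance.reserve] at hj
    · have := h.region_empty j (by simpa [JobInstance.reserve, hji] using hj)
      simp [JobInstance.reserve, hji, this]
  · intro j hj
    by_cases hji : j = i
    · subst hji; rwa [hai]
    · rw [haj j hji]; exact h.release_le j (hadm j hji hj)
  · intro j hj
    by_cases hji : j = i
    · subst hji; rwa [hai]
    · rw [haj j hji]; exact h.slack j (hadm j hji hj)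
  · intro j hj
    by_cases hji : j = i
    · subst hji; rw [hai, hei]; linarith
    · rw [haj j hji]; exact (h.start_le_end j (hadm j hji hj)).trans (hle j hji)
  · intro j x hx
    by_cases hji : j = i
    · subst hji; rw [hai, hei]; exact mem_region_reserve_self.1 hx
    · rw [haj j hji]
      rcases (mem_region_reserve hji).1 hx with ⟨h1, h2⟩ | ⟨h1, h2⟩
      · have h3 := h.region_subset j h2
        exact ⟨h3.1, h3.2.trans_le (hle j hji)⟩
      · have h3 := h.region_subset j h2
        rw [hel j hji (by linarith [h3.2])]
        exact ⟨by linarith [h3.1], by linarith [h3.2]⟩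
  · intro j
    by_cases hji : j = i
    · subst hji; simp [JobInstance.reserve]
    · exact (volume_region_reserve hji (h.measurable j)).1
  · intro j hj
    by_cases hji : j = i
    · subst hji; simp [JobInstance.reserve]
    · rw [(volume_region_reserve hji (h.measurable j)).2]
      exact h.volume_region j (hadm j hji hj)
  · intro j x hx
    by_cases hji : j = i
    · subst hji
      rw [mem_region_reserve_self] at hx
      exact ⟨_, hx.2, fun y hy => mem_region_reserve_self.2 ⟨hx.1.trans hy.1, hy.2⟩⟩
    · rcases (mem_region_reserve hji).1 hx with ⟨h1, h2⟩ | ⟨h1, h2⟩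
      · obtain ⟨y, hy, hys⟩ := h.right_open j x h2
        refine ⟨min y t, lt_min hy h1, fun z hz => (mem_region_reserve hji).2 (.inl ?_)⟩
        exact ⟨hz.2.trans_le (min_le_right _ _), hys ⟨hz.1, hz.2.trans_le (min_le_left _ _)⟩⟩
      · obtain ⟨y, hy, hys⟩ := h.right_open j _ h2
        refine ⟨y + I.proc i, by linarith, fun z hz => (mem_region_reserve hji).2 (.inr ?_)⟩
        exact ⟨h1.trans hz.1, hys ⟨by linarith [hz.1], by linarith [hz.2]⟩⟩
  · intro j k x hj hk
    by_cases hji : j = i <;> by_cases hki : k = i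
    · rw [hji, hki]
    · subst hji
      rw [mem_region_reserve_self] at hj
      rcases (mem_region_reserve hki).1 hk with ⟨h1, -⟩ | ⟨h1, -⟩ <;> linarith
    · subst hki
      rw [mem_region_reserve_self] at hk
      rcases (mem_region_reserve hji).1 hj with ⟨h1, -⟩ | ⟨h1, -⟩ <;> linarith
    · rcases (mem_region_reserve hji).1 hj with ⟨h1, h2⟩ | ⟨h1, h2⟩ <;>
        rcases (mem_region_reserve hki).1 hk with ⟨h3, h4⟩ | ⟨h3, h4⟩
      · exact h.disjoint j k x h2 h4
      · linarith
      · linarith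
      · exact h.disjoint j k _ h2 h4
  · intro j hj x hx
    by_cases hji : j = i
    · subst hji
      rw [hai, hei] at hx
      exact ⟨j, mem_region_reserve_self.2 hx⟩
    · have hjs := hadm j hji hj
      rcases lt_or_ge x t with h1 | h1
      · obtain ⟨k, hk⟩ := h.cover j hjs x (hback1 j hji x h1 hx)
        exact ⟨k, (mem_region_reserve (hne k x hk)).2 (.inl ⟨h1, hk⟩)⟩
      rcases lt_or_ge x (t + I.proc i) with h2 | h2
      · exact ⟨i, mem_region_reserve_self.2 ⟨h1, h2⟩⟩
      · obtain ⟨k, hk⟩ := h.cover j hjs _ (hback2 j hjs hji x h2 hx)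
        exact ⟨k, (mem_region_reserve (hne k _ hk)).2 (.inr ⟨h2, hk⟩)⟩
  · intro k x hx j hj hjk hxj
    by_cases hki : k = i
    · subst hki
      have hjs := hadm j hjk hj
      exact hstack j hjs (hmid j hjk x (mem_region_reserve_self.1 hx).1 hxj.2)
    · by_cases hji : j = i
      · subst hji
        rw [hai, hei] at hxj
        rcases (mem_region_reserve hki).1 hx with ⟨h1, -⟩ | ⟨h1, -⟩ <;> linarith [hxj.1, hxj.2]
      · have hjs := hadm j hji hj
        rcases (mem_region_reserve hki).1 hx with ⟨h1, h2⟩ | ⟨h1, h2⟩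
        · exact h.top k x h2 j hjs hjk (hback1 j hji x h1 hxj)
        · exact h.top k _ h2 j hjs hjk (hback2 j hjs hji x h1 hxj)
  · have hnew : ∀ j ∈ s.admitted, j ≠ i → e' j ≤ a' i ∨
        (a' j ≤ a' i ∧ e' i ≤ e' j ∧ I.proc i < β * I.proc j) := by
      intro j hjs hji
      rw [hai, hei, haj j hji]
      rcases lt_or_ge t (e j) with h1 | h1
      · rw [hel j hji h1]
        exact .inr ⟨ht j hjs, by linarith, hstack j hjs h1⟩
      · rw [her j hji h1]; exact .inl h1
    have hmono : ∀ j k, j ≠ i → k ≠ i → e j ≤ e k → e' j ≤ e' k := by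
      intro j k hj hk hjk
      rcases lt_or_ge t (e j) with h1 | h1
      · rw [hel j hj h1, hel k hk (h1.trans_le hjk)]; linarith
      · rw [her j hj h1]; exact hjk.trans (hle k hk)
    intro j hj k hk hjk
    by_cases hji : j = i
    · subst hji
      rcases hnew k (hadm k (Ne.symm hjk) hk) (Ne.symm hjk) with h1 | h1
      · exact .inr (.inl h1)
      · exact .inr (.inr (.inl h1))
    by_cases hki : k = i
    · subst hki
      rcases hnew j (hadm j hjk hj) hjk with h1 | h1
      · exact .inl h1
      · exact .inr (.inr (.inr h1))
    have hjs := hadm j hji hj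
    have hks := hadm k hki hk
    rw [haj j hji, haj k hki]
    rcases h.nested j hjs k hks hjk with h1 | h1 | ⟨h1, h2, h3⟩ | ⟨h1, h2, h3⟩
    · exact .inl (by rwa [her j hji (h1.trans (ht k hks))])
    · exact .inr (.inl (by rwa [her k hki (h1.trans (ht j hjs))]))
    · exact .inr (.inr (.inl ⟨h1, hmono j k hji hki h2, h3⟩))
    · exact .inr (.inr (.inr ⟨h1, hmono k j hki hji h2, h3⟩))
  · intro j hj
    by_cases hji : j = i
    · subst hji; rw [hai]
    · rw [haj j hji]; exact ht j (hadm j hji hj)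

lemma Reaches.exists_laminar {β δ : ℝ} (hβ0 : 0 ≤ β) (hβ1 : β ≤ 1) {t : ℝ} {s : State J}
    (h : I.Reaches 1 β δ t s) : ∃ a e, I.Laminar β δ s a e ∧ ∀ j ∈ s.admitted, a j ≤ t := by
  induction h with
  | start t h =>
    refine ⟨fun _ => 0, fun _ => 0, ?_, ?_⟩
    · constructor <;> simp [State.initial, State.admitted]
    · simp [State.initial, State.admitted]
  | admission t s i h hi ih =>
    obtain ⟨a, e, hl, ht⟩ := ih
    exact hl.reserve hβ0 hβ1 ht hi
  | wait t t' s h hn ht ih =>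
    obtain ⟨a, e, hl, hat⟩ := ih
    exact ⟨a, e, hl, fun j hj => (hat j hj).trans ht.1.1.le⟩

/-! ### Termination -/

lemma Reaches.exists_isOutcome [Finite J] {α β δ : ℝ} {t : ℝ} {s : State J}
    (h : I.Reaches α β δ t s) : ∃ s', I.IsOutcome α β δ s' := by
  classical
  have hev : ∀ s : State J, {u | I.IsEvent s u}.Finite := by
    intro s
    have h1 : {u | ∃ j, I.release j = u}.Finite := Set.finite_range I.release
    have h2 : {u | ∃ j, IsLUB (s.region j) u}.Finite := by
      have : {u | ∃ j, IsLUB (s.region j) u} = ⋃ j, {u | IsLUB (s.region j) u} := by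
        ext u; simp
      rw [this]
      refine Set.finite_iUnion fun j => Set.Subsingleton.finite fun u hu v hv => hu.unique hv
    exact (h1.union h2).subset fun u hu => hu
  suffices H : ∀ n m : ℕ, ∀ t s, I.Reaches α β δ t s → s.admittedᶜ.ncard = n →
      {u | t < u ∧ I.IsEvent s u}.ncard = m → ∃ s', I.IsOutcome α β δ s' from
    H _ _ t s h rfl rfl
  intro n
  induction n using Nat.strong_induction_on with
  | _ n ihn =>
  intro m
  induction m using Nat.strong_induction_on with
  | _ m ihm =>
  intro t s h hn hm
  by_cases hA : ∃ i, I.Admits β δ s t i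
  · obtain ⟨i, hi⟩ := hA
    refine ihn (I.reserve α s t i).admittedᶜ.ncard ?_ _ _ _ (.admission t s i h hi) rfl rfl
    rw [← hn]
    refine Set.ncard_lt_ncard ⟨fun j hj hj' => hj ?_, fun hsub => ?_⟩ (Set.toFinite _)
    · by_cases hji : j = i
      · simp [hji, State.admitted, reserve]
      · simpa [State.admitted, reserve, hji] using hj'
    · have : i ∈ s.admittedᶜ := fun h' => h' hi.1.2.1
      exact hsub this (by simp [State.admitted, reserve])
  · push Not at hA
    have hfin : {u | t < u ∧ I.IsEvent s u}.Finite := (hev s).subset fun u hu => hu.2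
    rcases Set.eq_empty_or_nonempty {u | t < u ∧ I.IsEvent s u} with h0 | h0
    · exact ⟨s, t, h, hA, fun u hu hu' => by
        have : u ∈ {u | t < u ∧ I.IsEvent s u} := ⟨hu, hu'⟩
        rw [h0] at this
        exact this⟩
    · obtain ⟨t', ht', hmin⟩ := Set.exists_min_image _ id hfin h0
      refine ihm _ ?_ t' s (.wait t t' s h hA ⟨ht', fun u hu => hmin u hu⟩) hn rfl
      rw [← hm]
      exact Set.ncard_lt_ncard ⟨fun u hu => ⟨ht'.1.trans hu.1, hu.2⟩,
        fun hsub => lt_irrefl t' (hsub ht').1⟩ hfin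

lemma exists_isOutcome [Finite J] (I : JobInstance J) (α β δ : ℝ) :
    ∃ s, I.IsOutcome α β δ s := by
  have : ∃ t, ∀ j, t ≤ I.release j := by
    obtain ⟨t, ht⟩ := (Set.finite_range I.release).bddBelow
    exact ⟨t, fun j => ht ⟨j, rfl⟩⟩
  obtain ⟨t, ht⟩ := this
  exact (Reaches.start (α := α) (β := β) (δ := δ) t ht).exists_isOutcome

/-! ### The schedule follows the regions -/

namespace Laminar

variable {β δ : ℝ} {s : State J} {a e : J → ℝ}

lemma mem_admitted (h : I.Laminar β δ s a e) {j : J} {x : ℝ} (hx : x ∈ s.region j) :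
    j ∈ s.admitted := fun hj => by
  simp [h.region_empty j hj] at hx

lemma admission_of_mem (h : I.Laminar β δ s a e) {j : J} (hj : j ∈ s.admitted) :
    s.admission j = some (a j) := by
  obtain ⟨τ, hτ⟩ := Option.ne_none_iff_exists'.1 hj
  rw [hτ, h.admission_eq j τ hτ]

lemma lt_end (h : I.Laminar β δ s a e) {j : J} (hj : j ∈ s.admitted) {x : ℝ}
    (hx : volume (s.region j ∩ Iio x) < ENNReal.ofReal (I.proc j)) : x < e j := by
  by_contra hcon
  have hsub : s.region j ⊆ Iio x := fun y hy =>
    (h.region_subset j hy).2.trans_le (not_lt.1 hcon)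
  rw [Set.inter_eq_left.2 hsub, h.volume_region j hj] at hx
  exact lt_irrefl _ hx

/-- Since regions are right-open, a piece of positive length remains after `x`; a job run in its
region is thus still pending there. -/
lemma volume_inter_Iio_lt (h : I.Laminar β δ s a e) {j : J} {x : ℝ} (hx : x ∈ s.region j) :
    volume (s.region j ∩ Iio x) < ENNReal.ofReal (I.proc j) := by
  obtain ⟨y, hxy, hy⟩ := h.right_open j x hx
  rw [← h.volume_region j (h.mem_admitted hx)]
  have hfin : volume (s.region j ∩ Iio x) ≠ ⊤ := by
    refine ((measure_mono inter_subset_left).trans_lt ?_).ne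
    rw [h.volume_region j (h.mem_admitted hx)]
    exact ENNReal.ofReal_lt_top
  have hd : Disjoint (s.region j ∩ Iio x) (Ico x y) :=
    Set.disjoint_left.2 fun z hz hz' => not_lt.2 hz'.1 hz.2
  calc volume (s.region j ∩ Iio x)
      < volume (s.region j ∩ Iio x) + volume (Ico x y) :=
        ENNReal.lt_add_right hfin (by simp [hxy])
    _ = volume (s.region j ∩ Iio x ∪ Ico x y) := (measure_union hd measurableSet_Ico).symm
    _ ≤ volume (s.region j) := measure_mono (union_subset inter_subset_left hy)

/-- Running every job in its region is a schedule of the scheduling routine. -/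
lemma exists_isSPTSchedule (h : I.Laminar β δ s a e) (hβ1 : β ≤ 1) :
    ∃ σ, I.IsSPTSchedule s.admission σ := by
  classical
  let σ : ℝ → Option J := fun x => if hx : ∃ k, x ∈ s.region k then some hx.choose else none
  have hσ : ∀ x j, σ x = some j ↔ x ∈ s.region j := by
    intro x j
    by_cases hx : ∃ k, x ∈ s.region k
    · simp only [σ, dif_pos hx, Option.some.injEq]
      exact ⟨fun hj => hj ▸ hx.choose_spec, fun hj => h.disjoint _ _ x hx.choose_spec hj⟩
    · simp only [σ, dif_neg hx, reduceCtorEq, false_iff]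
      exact fun hj => hx ⟨j, hj⟩
  have hset : ∀ t j, {x | x < t ∧ σ x = some j} = s.region j ∩ Iio t := by
    intro t j
    ext x
    simp [hσ, and_comm]
  have hpend : ∀ t j, I.Pending s.admission σ t j → j ∈ s.admitted ∧ t ∈ Ico (a j) (e j) := by
    rintro t j ⟨⟨τ, hτ, hle⟩, hv⟩
    have hj : j ∈ s.admitted := by simp [State.admitted, hτ]
    rw [hset] at hv
    exact ⟨hj, h.admission_eq j τ hτ ▸ hle, h.lt_end hj hv⟩
  refine ⟨σ, fun j => ?_, fun t j hj => ?_, fun t ht k hk => ?_⟩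
  · simpa only [hσ, ofPred_mem_eq] using h.measurable j
  · rw [hσ] at hj
    refine ⟨⟨⟨a j, h.admission_of_mem (h.mem_admitted hj), (h.region_subset j hj).1⟩, ?_⟩, ?_⟩
    · rw [hset]
      exact h.volume_inter_Iio_lt hj
    · intro k hk
      obtain ⟨hk1, hk2⟩ := hpend t k hk
      by_cases hkj : k = j
      · rw [hkj]
      · nlinarith [h.top j t hj k hk1 hkj hk2, I.proc_nonneg k]
  · obtain ⟨hk1, hk2⟩ := hpend t k hk
    obtain ⟨i, hi⟩ := h.cover k hk1 t hk2
    rw [(hσ t i).2 hi] at ht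
    cases ht

/-- The scheduling routine runs every job exactly in its region. -/
lemma eq_some_iff [Finite J] (h : I.Laminar β δ s a e) (hβ1 : β ≤ 1) {σ : ℝ → Option J}
    (hσ : I.IsSPTSchedule s.admission σ) (x : ℝ) (j : J) : σ x = some j ↔ x ∈ s.region j := by
  -- Continuous induction: `B` collects the times of disagreement, and agreement before its infimum
  -- `b` is extended to an interval `[b, c')`, a contradiction.
  set B : Set ℝ := {x | ¬ ∀ j, σ x = some j ↔ x ∈ s.region j} with hB
  suffices hBe : B = ∅ by
    by_contra hcon
    have : x ∈ B := fun hx => hcon (hx j)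
    rw [hBe] at this
    exact this
  have hpa : ∀ y j, I.Pending s.admission σ y j → j ∈ s.admitted ∧ a j ≤ y := by
    rintro y j ⟨⟨τ, hτ, hle⟩, -⟩
    exact ⟨by simp [State.admitted, hτ], h.admission_eq j τ hτ ▸ hle⟩
  by_contra hne
  have hne : B.Nonempty := Set.nonempty_iff_ne_empty.2 hne
  obtain ⟨l, hl⟩ := (Set.finite_range a).bddBelow
  have hbdd : BddBelow B := by
    refine ⟨l, fun y hy => ?_⟩
    by_contra hyl
    refine hy fun j => ⟨fun hj => ?_, fun hj => ?_⟩
    · linarith [(hpa y j (hσ.run y j hj).1).2, hl ⟨j, rfl⟩]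
    · linarith [(h.region_subset j hj).1, hl ⟨j, rfl⟩]
  set b := sInf B with hb
  have hbefore : ∀ y < b, ∀ j, σ y = some j ↔ y ∈ s.region j := fun y hy => by
    by_contra hcon
    exact notMem_of_lt_csInf hy hbdd hcon
  -- No `a j` lies strictly between `b` and `c`, so every job pending in `[b, c)` has a span
  -- containing `b`.
  obtain ⟨c, hbc, hc⟩ : ∃ c, b < c ∧ ∀ j, b < a j → c ≤ a j := by
    have hfin : {y ∈ range a | b < y}.Finite := (Set.finite_range a).subset (sep_subset _ _)
    rcases Set.eq_empty_or_nonempty {y ∈ range a | b < y} with h0 | h0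
    · refine ⟨b + 1, by linarith, fun j hj => ?_⟩
      have : a j ∈ {y ∈ range a | b < y} := ⟨⟨j, rfl⟩, hj⟩
      rw [h0] at this
      exact this.elim
    · obtain ⟨c, hc, hmin⟩ := Set.exists_min_image _ id hfin h0
      exact ⟨c, hc.2, fun j hj => hmin (a j) ⟨⟨j, rfl⟩, hj⟩⟩
  have hac : ∀ j, ∀ y < c, a j ≤ y → a j ≤ b := fun j y hy hj => by
    by_contra hcon
    linarith [hc j (not_le.1 hcon)]
  have hpend : ∀ y j, b ≤ y → y < c → I.Pending s.admission σ y j →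
      j ∈ s.admitted ∧ b ∈ Ico (a j) (e j) := by
    intro y j hby hyc hj
    obtain ⟨h1, h2⟩ := hpa y j hj
    refine ⟨h1, hac j y hyc h2, h.lt_end h1 (lt_of_le_of_lt (measure_mono ?_) hj.2)⟩
    exact fun z hz => ⟨lt_of_lt_of_le hz.2 hby, (hbefore z hz.2 j).2 hz.1⟩
  suffices hgo : ∃ c', b < c' ∧ ∀ y, b ≤ y → y < c' → ∀ j, σ y = some j ↔ y ∈ s.region j by
    obtain ⟨c', hc', hgo⟩ := hgo
    obtain ⟨y, hy, hyc⟩ := exists_lt_of_csInf_lt hne hc'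
    exact hy (hgo y (csInf_le hbdd hy) hyc)
  by_cases hk : ∃ k, b ∈ s.region k
  · obtain ⟨k, hk⟩ := hk
    obtain ⟨c₁, hbc₁, hc₁⟩ := h.right_open k b hk
    refine ⟨min c c₁, lt_min hbc hbc₁, fun y hby hy => ?_⟩
    have hyc : y < c := hy.trans_le (min_le_left _ _)
    have hyk : y ∈ s.region k := hc₁ ⟨hby, hy.trans_le (min_le_right _ _)⟩
    have hpk : I.Pending s.admission σ y k := by
      refine ⟨⟨a k, h.admission_of_mem (h.mem_admitted hk), (h.region_subset k hyk).1⟩, ?_⟩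
      refine lt_of_le_of_lt (measure_mono fun z hz => ?_) (h.volume_inter_Iio_lt hyk)
      refine ⟨?_, hz.1⟩
      rcases lt_or_ge z b with hzb | hzb
      · exact (hbefore z hzb k).1 hz.2
      · exact hc₁ ⟨hzb, hz.1.trans (hy.trans_le (min_le_right _ _))⟩
    have hyσ : σ y = some k := by
      cases hj : σ y with
      | none => exact (hσ.idle y hj k hpk).elim
      | some j =>
        obtain ⟨h1, h2⟩ := hσ.run y j hj
        obtain ⟨h3, h4⟩ := hpend y j hby hyc h1
        by_contra hjk
        have hjk : j ≠ k := fun h' => hjk (by rw [h'])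
        -- Any other pending job is strictly longer than `k` by `top`, so ties cannot divert the
        -- schedule.
        nlinarith [h.top k b hk j h3 hjk h4, I.proc_nonneg j, h2 k hpk]
    intro j
    rw [hyσ, Option.some.injEq]
    exact ⟨fun hj => hj ▸ hyk, fun hj => h.disjoint k j y hyk hj⟩
  -- Outside all regions `b` lies in no span by `cover`, so up to `c` nothing is pending and no
  -- region has a point.
  · refine ⟨c, hbc, fun y hby hyc j => ⟨fun hj => ?_, fun hj => ?_⟩⟩
    · obtain ⟨h1, h2⟩ := hpend y j hby hyc (hσ.run y j hj).1
      exact (hk (h.cover j h1 b h2)).elim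
    · have h1 := h.region_subset j hj
      exact (hk (h.cover j (h.mem_admitted hj) b
        ⟨hac j y hyc h1.1, hby.trans_lt h1.2⟩)).elim

lemma completesOnTime [Finite J] (h : I.Laminar β δ s a e) (hβ1 : β ≤ 1) {σ : ℝ → Option J}
    (hσ : I.IsSPTSchedule s.admission σ) {j : J} (hj : j ∈ s.admitted)
    (hd : e j ≤ I.deadline j) : I.CompletesOnTime σ j := by
  rw [CompletesOnTime, ← h.volume_region j hj]
  refine measure_mono fun x hx => ?_
  have h1 := h.region_subset j hx
  exact ⟨⟨(h.release_le j hj).trans h1.1, h1.2.le.trans hd⟩, (h.eq_some_iff hβ1 hσ x j).2 hx⟩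

/-! ### The forest of spans and the final count -/

/-- The spans form a forest: every job has at most one parent, and the span of a job is covered by
its own region and the spans of its children. -/
lemma exists_parent [Fintype J] (h : I.Laminar β δ s a e) (hβ1 : β ≤ 1) :
    ∃ parent : s.admitted → Option s.admitted,
      (∀ c j, parent c = some j → I.proc c < β * I.proc j) ∧
      ∀ j : s.admitted, ∀ x ∈ Ico (a j) (e j), x ∉ s.region j →
        ∃ c, parent c = some j ∧ x ∈ Ico (a c) (e c) := by
  classical
  let N : s.admitted → s.admitted → Prop := fun i j =>
    a j ≤ a i ∧ e i ≤ e j ∧ I.proc i < β * I.proc j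
  have hNp : ∀ i j, N i j → I.proc i < I.proc j := fun i j hij => by
    nlinarith [hij.2.2, I.proc_nonneg j]
  have hN : ∀ i j : s.admitted, ∀ x, x ∈ Ico (a i) (e i) → x ∈ Ico (a j) (e j) → i ≠ j →
      N i j ∨ N j i := by
    intro i j x hi hj hij
    rcases h.nested i i.2 j j.2 (fun h' => hij (Subtype.ext h')) with h1 | h1 | h1 | h1
    · linarith [hi.2, hj.1]
    · linarith [hi.1, hj.2]
    · exact .inl h1
    · exact .inr h1
  have hmin : ∀ c, (∃ j, N c j) → ∃ j, N c j ∧ ∀ m, N c m → I.proc j ≤ I.proc m := by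
    rintro c hc
    obtain ⟨j, hj, hj'⟩ := Set.exists_min_image {j | N c j} (fun j => I.proc j)
      (Set.toFinite _) hc
    exact ⟨j, hj, hj'⟩
  -- The parent is a shortest job among those whose span encloses that of `c`.
  let parent : s.admitted → Option s.admitted := fun c =>
    if hc : ∃ j, N c j then some (hmin c hc).choose else none
  have hpar : ∀ c j, parent c = some j → N c j ∧ ∀ m, N c m → I.proc j ≤ I.proc m := by
    intro c j hcj
    by_cases hc : ∃ j, N c j
    · simp only [parent, dif_pos hc, Option.some.injEq] at hcj
      rw [← hcj]
      exact (hmin c hc).choose_spec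
    · simp only [parent, dif_neg hc, reduceCtorEq] at hcj
  refine ⟨parent, fun c j hcj => (hpar c j hcj).1.2.2, fun j x hx hxj => ?_⟩
  obtain ⟨k, hk⟩ := h.cover j j.2 x hx
  have hkj : (j : J) ≠ k := fun h' => hxj (h' ▸ hk)
  have hkp : I.proc k < I.proc j := by
    nlinarith [h.top k x hk j j.2 hkj hx, I.proc_nonneg j]
  -- The child sought is a longest job shorter than `j` whose span contains `x`. A parent `m ≠ j` of
  -- it would be comparable with `j`: inside `j` it contradicts the maximality of `c`, around `j`
  -- the minimality of the parent.
  obtain ⟨c, ⟨hc, hcj⟩, hmax⟩ := Set.exists_max_image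
    {c : s.admitted | x ∈ Ico (a c) (e c) ∧ I.proc c < I.proc j} (fun c => I.proc c)
    (Set.toFinite _) ⟨⟨k, h.mem_admitted hk⟩, h.region_subset k hk, hkp⟩
  have hNc : N c j := by
    rcases hN c j x hc hx (fun h' => by simp [h'] at hcj) with h1 | h1
    · exact h1
    · linarith [hNp _ _ h1]
  refine ⟨c, ?_, hc⟩
  obtain ⟨m, hm⟩ : ∃ m, parent c = some m := by
    have : ∃ j, N c j := ⟨j, hNc⟩
    exact ⟨_, dif_pos this⟩
  obtain ⟨hm1, hm2⟩ := hpar c m hm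
  have hmx : x ∈ Ico (a m) (e m) := ⟨hm1.1.trans hc.1, hc.2.trans_le hm1.2.1⟩
  by_cases hmj : m = j
  · rw [hm, hmj]
  · have h1 := hm2 j hNc
    rcases hN m j x hmx hx hmj with h2 | h2
    · linarith [hmax m ⟨hmx, hNp _ _ h2⟩, hNp _ _ hm1]
    · linarith [hNp _ _ h2]

/-- At least half of the admitted jobs have a region that ends before the deadline. -/
lemma ncard_admitted_le [Finite J] (h : I.Laminar β (2 * β) s a e) (hβ0 : 0 < β)
    (hβ1 : β ≤ 1 / 4) :
    s.admitted.ncard ≤ 2 * {j ∈ s.admitted | e j ≤ I.deadline j}.ncard := by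
  classical
  have := Fintype.ofFinite J
  obtain ⟨parent, hpar, hcov⟩ := h.exists_parent (by linarith)
  have hw0 : ∀ c : s.admitted, 0 ≤ e c - a c := fun c => by linarith [h.start_le_end c c.2]
  have hsum := sum_sign_nonneg (fun j : s.admitted => I.proc j) (fun j => e j - a j) parent
    (fun j => ¬ e j ≤ I.deadline j) hβ0 hβ1 (fun j => I.proc_nonneg j) hpar ?_ ?_
  · simp only [ite_not, Finset.sum_ite, Finset.sum_const, nsmul_eq_mul, mul_one, mul_neg] at hsum
    have hcard := Finset.card_filter_add_card_filter_not (s := (Finset.univ : Finset s.admitted))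
      (fun j => e j ≤ I.deadline j)
    have h1 : s.admitted.ncard = (Finset.univ : Finset s.admitted).card := by
      rw [Finset.card_univ, ← Nat.card_eq_fintype_card]
      rfl
    have h2 : {j ∈ s.admitted | e j ≤ I.deadline j}.ncard
        = (Finset.univ.filter fun j : s.admitted => e j ≤ I.deadline j).card := by
      rw [← Finset.card_map (Function.Embedding.subtype _), ← Set.ncard_coe_finset]
      congr 1
      ext j
      simp [and_comm]
    omega
  · intro j
    have hs : 0 ≤ ∑ c, if parent c = some j then e c - a c else 0 :=
      Finset.sum_nonneg fun c _ => by
        split_ifs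
        exacts [hw0 c, le_rfl]
    -- The covering of the span is turned into an inequality of lengths by subadditivity of Lebesgue
    -- measure.
    rw [← ENNReal.ofReal_le_ofReal_iff (add_nonneg (I.proc_nonneg j) hs),
      ENNReal.ofReal_add (I.proc_nonneg j) hs, ENNReal.ofReal_sum_of_nonneg fun c _ => by
        split_ifs
        exacts [hw0 c, le_rfl], ← Real.volume_Ico, ← h.volume_region j j.2]
    have hsub : Ico (a j) (e j) ⊆ s.region j ∪
        ⋃ c : s.admitted, if parent c = some j then Ico (a c) (e c) else ∅ := by
      intro x hx
      by_cases hxj : x ∈ s.region j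
      · exact .inl hxj
      · obtain ⟨c, hc, hcx⟩ := hcov j x hx hxj
        exact .inr (mem_iUnion.2 ⟨c, by rwa [if_pos hc]⟩)
    refine (measure_mono hsub).trans ((measure_union_le _ _).trans (add_le_add le_rfl ?_))
    refine (measure_iUnion_fintype_le _ _).trans (Finset.sum_le_sum fun c _ => ?_)
    split_ifs <;> simp
  -- This is where `δ = 2β` enters: `j` was admitted at least `(1 + 2β) p j` before its deadline, so
  -- a late end makes its span longer than that.
  · intro j hj
    linarith [h.slack j j.2]

end Laminar

end JobInstance

end RegionScheduling

theorem theorem4 {J : Type*} [Finite J] (I : RegionScheduling.JobInstance J) (ε : ℝ)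
    (hε0 : 0 < ε) (hε1 : ε ≤ 1) (hslack : I.HasSlack ε) :
    (∃ s σ, I.IsExecution 1 (ε / 4) (ε / 2) s σ) ∧
    ∀ s σ, I.IsExecution 1 (ε / 4) (ε / 2) s σ →
      s.admitted.ncard ≤ 2 * {j ∈ s.admitted | I.CompletesOnTime σ j}.ncard := by
  have hβ1 : ε / 4 ≤ 1 := by linarith
  refine ⟨?_, ?_⟩
  · obtain ⟨s, t, hr, hs⟩ := I.exists_isOutcome 1 (ε / 4) (ε / 2)
    obtain ⟨a, e, hl, -⟩ := hr.exists_laminar (by linarith) hβ1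
    obtain ⟨σ, hσ⟩ := hl.exists_isSPTSchedule hβ1
    exact ⟨s, σ, ⟨t, hr, hs⟩, hσ⟩
  · rintro s σ ⟨⟨t, hr, -⟩, hσ⟩
    obtain ⟨a, e, hl, -⟩ := hr.exists_laminar (by linarith) hβ1
    rw [show ε / 2 = 2 * (ε / 4) by ring] at hl
    refine (hl.ncard_admitted_le (by linarith) (by linarith)).trans
      (Nat.mul_le_mul_left 2 (Set.ncard_le_ncard (fun j hj => ?_) (Set.toFinite _)))
    exact ⟨hj.1, hl.completesOnTime hβ1 hσ hj.1 hj.2⟩
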